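/- Let $b\ge 2$ be an integer and $\Sigma_b=\{0,1,\dots,b-1\}$. For a string $w\in\Sigma_b^*$ let $\mathrm{real}_b(w)=\sum_{i=1}^{|w|}w[i-1]\,b^{-i}$. For $x\in[0,1)$ let $\mathrm{seq}_b(x)\in\Sigma_b^\infty$ be the unique base-$b$ expansion of $x$ that does not end with infinitely many digits $b-1$, and for $A\subseteq[0,1)$ let $\mathrm{seq}_b(A)=\{\mathrm{seq}_b(x): x\in A\}$. *Dimension of real numbers.* A $\Sigma_b$-finite-state transducer $T$ consists of a finite set $Q$ of states, a transition function $\delta:Q\times\Sigma_b\to Q$, an output function $\nu:Q\times\Sigma_b\to\Sigma_b^*$ and an initial state $q_0\in Q$; on input $\pi\in\Sigma_b^*$ it outputs the concatenation $T(\pi)$ of the strings output while reading $\pi$ from $q_0$. With $\min\emptyset=\infty$ put $$\mathrm K^T(w)=\min\{|\pi| : T(\pi)=w\},\qquad \mathrm K^T_\delta(x)=\min\{\mathrm K^T(w) : w\in\Sigma_b^*,\ |\mathrm{real}_b(w)-x|<\delta\},$$ $$\dim_{\mathrm{FS}}^b(x)=\inf_T\liminf_{\delta\to0^+}\frac{\mathrm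 K^T_\delta(x)}{\log_b(1/\delta)},\qquad \dim_{\mathrm{FS}}^b(A)=\inf_T\sup_{x\in A}\liminf_{\delta\to0^+}\frac{\mathrm K^T_\delta(x)}{\log_b(1/\delta)},$$ where $T$ ranges over all $\Sigma_b$-finite-state transducers, and the supremum over the empty set is $0$. *Dimension of sequences.* A finite-state gambler $G$ on a finite alphabet $\Sigma$ consists of a finite set of states with a transition function and an initial state, a positive number $k$ of accounts with nonnegative rational initial capitals $c_1,\dots,c_k$, and for each state $q$ and account $i$ a rational-valued probability measure $\beta_i(q)$ on $\Sigma$. Its martingale is $d_G=\sum_{i=1}^k d_{G,i}$, where $d_{G,i}(\lambda)=c_i$ for the empty string $\lambda$, and $d_{G,i}(wa)=|\Sigma|\,\beta_i(q_w)(a)\,d_{G,i}(w)$ for $w\in\Sigma^*$, $a\in\Sigma$, with $q_w$ the state reached after reading $w$. For a real $s\ge0$ its $s$-gale is $d_G^{(s)}(w)=|\Sigma|^{(s-1)|w|}d_G(w)$, and it succeeds on $S\in\Sigma^\infty$ if $\limsup_{n\to\infty}d_G^{(s)}(S[0..n-1])=\infty$. For $X\subseteq\Sigma^\infty$, $\dim_{\mathrm{FS}}(X)$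 is the infimum of all real $s\ge0$ for which there is a single finite-state gambler whose $s$-gale succeeds on every $S\in X$; and $\dim_{\mathrm{FS}}(S)=\dim_{\mathrm{FS}}(\{S\})$ for $S\in\Sigma^\infty$. **Theorem.** For every integer $b\ge2$, every $x\in[0,1)$ and every $A\subseteq[0,1)$, $$\dim_{\mathrm{FS}}^b(x)=\dim_{\mathrm{FS}}(\mathrm{seq}_b(x))\qquad\text{and}\qquad \dim_{\mathrm{FS}}^b(A)=\dim_{\mathrm{FS}}(\mathrm{seq}_b(A)).$$ -/

import Mathlib

open Filter Topology
open scoped ENNReal NNReal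

/-- The prefix `S[0..n-1]` of an infinite sequence. -/
def seqPrefix {α : Type} (S : ℕ → α) (n : ℕ) : List α :=
  List.ofFn (fun i : Fin n => S i)

/-! ### Finite-state transducers -/

/-- A finite-state transducer whose input and output alphabet is `α`.  The (finite) set of states
is nonempty since it contains `start`. -/
structure FST (α : Type) where
  Q : Type
  finite : Finite Q
  step : Q → α → Q
  out : Q → α → List α
  start : Q

namespace FST

variable {α : Type}

/-- The state reached from `q` after reading a string. -/
def run (T : FST α) (q : T.Q) (w : List α) : T.Q :=
  w.foldl T.step q

/-- The output from state `q` on an input string. -/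
def outFrom (T : FST α) : T.Q → List α → List α
  | _, [] => []
  | q, a :: w => T.out q a ++ T.outFrom (T.step q a) w

/-- Appending one input symbol: `ν(q, wa) = ν(q, w) ν(δ(q, w), a)`. -/
theorem outFrom_concat (T : FST α) (q : T.Q) (w : List α) (a : α) :
    T.outFrom q (w ++ [a]) = T.outFrom q w ++ T.out (T.run q w) a := by
  induction w generalizing q with
  | nil => simp [outFrom, run]
  | cons c w ih => simp [outFrom, run, ih]

/-- The output `T(w)` of the transducer on input `w`. -/
def eval (T : FST α) (w : List α) : List α :=
  T.outFrom T.start w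

/-- The `T`-information content of a string: the least length of an input on which `T` outputs
`w`, and `⊤` if there is no such input. -/
noncomputable def K (T : FST α) (w : List α) : ℕ∞ :=
  ⨅ (p : List α) (_ : T.eval p = w), (p.length : ℕ∞)

end FST

/-! ### Base-`b` expansions and the information content of a real number -/

/-- The real number with base-`b` expansion `0.w000...`. -/
noncomputable def realOfStr {b : ℕ} [NeZero b] (w : List (Fin b)) : ℝ :=
  Real.ofDigits (fun i => w.getD i 0)

/-- The base-`b` expansion of `x ∈ [0,1)`, its `i`-th digit being `⌊x b ^ (i + 1)⌋ mod b`. -/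
noncomputable def seqOfReal (b : ℕ) [NeZero b] (x : ℝ) : ℕ → Fin b :=
  Real.digits x b

/-- `seqOfReal b x` is the unique sequence of base-`b` digits that represents `x` and does not end
with infinitely many digits `b - 1`. -/
theorem seqOfReal_eq_iff {b : ℕ} [NeZero b] (hb : 2 ≤ b) {x : ℝ} (hx : x ∈ Set.Ico (0 : ℝ) 1)
    (S : ℕ → Fin b) :
    S = seqOfReal b x ↔ Real.ofDigits S = x ∧ ∀ N, ∃ n, N ≤ n ∧ (S n : ℕ) ≠ b - 1 := by
  have hb1 : 1 < b := hb
  have hb0 : (0 : ℝ) < b := by positivity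
  constructor
  · rintro rfl
    refine ⟨Real.ofDigits_digits hb1 hx, ?_⟩
    by_contra! h
    obtain ⟨N, hN⟩ := h
    have h1 := Real.ofDigits_eq_sum_add_ofDigits (seqOfReal b x) N
    have h2 : (fun i => seqOfReal b x (i + N)) = fun _ => ⟨b - 1, Nat.sub_one_lt_of_lt hb1⟩ := by
      funext i
      exact Fin.ext (hN _ (Nat.le_add_left N i))
    have h0 : Real.ofDigits (seqOfReal b x) = x := Real.ofDigits_digits hb1 hx
    rw [h2, Real.ofDigits_const_last_eq_one' hb1, mul_one, h0] at h1
    have h3 := Real.ofDigits_digits_sum_eq (b := b) hx N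
    have h4 := Nat.lt_floor_add_one ((b : ℝ) ^ N * x)
    rw [← h3] at h4
    have hp : (0 : ℝ) < (b : ℝ) ^ N := by positivity
    have h5 : (b : ℝ) ^ N * x =
        b ^ N * ∑ i ∈ Finset.range N, Real.ofDigitsTerm (Real.digits x b) i + 1 := by
      conv_lhs => rw [h1]
      rw [mul_add, mul_inv_cancel₀ hp.ne']
      rfl
    linarith
  · rintro ⟨hS, hlt⟩
    have hsum : ∀ n, ∃ k : ℕ,
        (b : ℝ) ^ n * ∑ i ∈ Finset.range n, Real.ofDigitsTerm S i = k := by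
      intro n
      induction n with
      | zero => exact ⟨0, by simp⟩
      | succ n ih =>
        obtain ⟨k, hk⟩ := ih
        refine ⟨b * k + S n, ?_⟩
        have hp : (0 : ℝ) < (b : ℝ) ^ (n + 1) := by positivity
        rw [Finset.sum_range_succ, mul_add, pow_succ', mul_assoc, hk, Real.ofDigitsTerm,
          ← pow_succ', mul_left_comm, mul_inv_cancel₀ hp.ne']
        push_cast
        ring
    have hone : ∀ n, Real.ofDigits (fun i => S (i + n)) < 1 := by
      intro n
      obtain ⟨m, hm, hne⟩ := hlt n
      rw [← Real.ofDigits_const_last_eq_one' hb1]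
      have hle : ∀ i : ℕ, ((S (i + n) : ℕ) : ℝ) ≤ ((b - 1 : ℕ) : ℝ) := fun i => by
        have := (S (i + n)).2
        exact_mod_cast (by omega)
      refine Summable.tsum_lt_tsum (i := m - n) (fun i => ?_) ?_ Real.summable_ofDigitsTerm
        Real.summable_ofDigitsTerm
      · exact mul_le_mul_of_nonneg_right (hle i) (by positivity)
      · refine mul_lt_mul_of_pos_right ?_ (by positivity)
        have h1 := (S m).2
        have h2 : m - n + n = m := by omega
        simp only [h2]
        exact_mod_cast (by omega)
    have hfloor : ∀ n, (b : ℝ) ^ n * ∑ i ∈ Finset.range n, Real.ofDigitsTerm S i =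
        b ^ n * ∑ i ∈ Finset.range n, Real.ofDigitsTerm (Real.digits x b) i := by
      intro n
      rw [Real.ofDigits_digits_sum_eq hx n]
      obtain ⟨k, hk⟩ := hsum n
      have hp : (0 : ℝ) < (b : ℝ) ^ n := by positivity
      have h1 := Real.ofDigits_eq_sum_add_ofDigits S n
      rw [hS] at h1
      have h2 : (b : ℝ) ^ n * x = k + Real.ofDigits (fun i => S (i + n)) := by
        conv_lhs => rw [h1]
        rw [mul_add, hk, mul_inv_cancel_left₀ hp.ne']
      have h3 := Real.ofDigits_nonneg (fun i => S (i + n))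
      rw [hk, eq_comm, Nat.cast_inj, Nat.floor_eq_iff (by rw [h2]; positivity), h2]
      exact ⟨by linarith, by linarith [hone n]⟩
    have heq : ∀ n, ∑ i ∈ Finset.range n, Real.ofDigitsTerm S i =
        ∑ i ∈ Finset.range n, Real.ofDigitsTerm (Real.digits x b) i := fun n =>
      mul_left_cancel₀ (pow_pos hb0 n).ne' (hfloor n)
    funext n
    have h1 := heq (n + 1)
    rw [Finset.sum_range_succ, Finset.sum_range_succ, heq n, add_right_inj] at h1
    have h2 := mul_right_cancel₀ (inv_pos.2 (pow_pos hb0 (n + 1))).ne' h1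
    exact Fin.ext (by exact_mod_cast h2)

/-- The base-`b` `T`-information content of `x` at precision `δ`. -/
noncomputable def FST.KReal {b : ℕ} [NeZero b] (T : FST (Fin b)) (δ : ℝ) (x : ℝ) : ℕ∞ :=
  ⨅ (w : List (Fin b)) (_ : |realOfStr w - x| < δ), T.K w

/-- The lower limit of `K^T_δ(x) / log_b (1/δ)` as `δ → 0+`. -/
noncomputable def FST.lowerRate {b : ℕ} [NeZero b] (T : FST (Fin b)) (x : ℝ) : ℝ≥0∞ :=
  liminf (fun δ : ℝ => (T.KReal δ x : ℝ≥0∞) / ENNReal.ofReal (Real.logb b (1 / δ))) (𝓝[>] 0)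

/-- The base-`b` finite-state dimension of a real number. -/
noncomputable def dimFSReal (b : ℕ) [NeZero b] (x : ℝ) : ℝ≥0∞ :=
  ⨅ T : FST (Fin b), T.lowerRate x

/-- The base-`b` finite-state dimension of a set of real numbers. -/
noncomputable def dimFSRealSet (b : ℕ) [NeZero b] (A : Set ℝ) : ℝ≥0∞ :=
  ⨅ T : FST (Fin b), ⨆ x ∈ A, T.lowerRate x

/-! ### Finite-state gamblers and the finite-state dimension of sets of sequences -/

/-- A (multi-account) finite-state gambler on the alphabet `α`: finitely many states, a transition
function, an initial state, a positive number of accounts, and for each account a nonnegative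
rational initial capital and, in each state, a rational probability measure on `α` that says how
the capital of the account is distributed on the possible next symbols. -/
structure FSGambler (α : Type) [Fintype α] where
  Q : Type
  finite : Finite Q
  step : Q → α → Q
  start : Q
  accounts : ℕ
  accounts_pos : 0 < accounts
  bet : Q → Fin accounts → α → ℚ≥0
  bet_sum : ∀ q i, ∑ a, bet q i a = 1
  initCapital : Fin accounts → ℚ≥0

namespace FSGambler

variable {α : Type} [Fintype α]

/-- The state reached from `q` after reading a string. -/
def run (G : FSGambler α) (q : G.Q) (w : List α) : G.Q :=
  w.foldl G.step q

/-- The factor by which account `i` is multiplied while the string is read from state `q`; payoffs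
are fair with respect to the uniform measure on `α`. -/
def growth (G : FSGambler α) (i : Fin G.accounts) : G.Q → List α → ℚ≥0
  | _, [] => 1
  | q, a :: w => (Fintype.card α : ℚ≥0) * G.bet q i a * G.growth i (G.step q a) w

/-- The capital of account `i` after betting on the successive symbols of `w`. -/
def account (G : FSGambler α) (i : Fin G.accounts) (w : List α) : ℚ≥0 :=
  G.initCapital i * G.growth i G.start w

/-- The martingale recursion of an account. -/
theorem account_concat (G : FSGambler α) (i : Fin G.accounts) (w : List α) (a : α) :
    G.account i (w ++ [a]) =
      (Fintype.card α : ℚ≥0) * G.bet (G.run G.start w) i a * G.account i w := by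
  have h : ∀ q : G.Q, G.growth i q (w ++ [a]) =
      (Fintype.card α : ℚ≥0) * G.bet (G.run q w) i a * G.growth i q w := by
    induction w with
    | nil => intro q; simp [growth, run]
    | cons c w ih =>
      intro q
      have hrun : G.run q (c :: w) = G.run (G.step q c) w := rfl
      simp only [List.cons_append, growth, ih, hrun]
      ring
  simp only [account, h]
  ring

/-- The martingale of the gambler: the total capital after betting on the symbols of `w`. -/
def martingale (G : FSGambler α) (w : List α) : ℚ≥0 :=
  ∑ i, G.account i w

/-- The `s`-gale `w ↦ |α| ^ ((s - 1) |w|) d_G(w)` of the gambler. -/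
noncomputable def gale (G : FSGambler α) (s : ℝ≥0) (w : List α) : ℝ :=
  (Fintype.card α : ℝ) ^ (((s : ℝ) - 1) * (w.length : ℝ)) * ((G.martingale w : ℚ≥0) : ℝ)

/-- The `s`-gale of the gambler succeeds on a sequence if it has upper limit `∞` along it. -/
def Succeeds (G : FSGambler α) (s : ℝ≥0) (S : ℕ → α) : Prop :=
  limsup (fun n : ℕ => ENNReal.ofReal (G.gale s (seqPrefix S n))) atTop = ⊤

end FSGambler

/-- The finite-state dimension of a set of sequences: the infimum of all `s ≥ 0` such that the
`s`-gale of a single finite-state gambler succeeds on all elements of the set. -/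
noncomputable def dimFSSeqSet {α : Type} [Fintype α] (X : Set (ℕ → α)) : ℝ≥0∞ :=
  ⨅ (s : ℝ≥0) (_ : ∃ G : FSGambler α, ∀ S ∈ X, G.Succeeds s S), (s : ℝ≥0∞)

/-- The finite-state dimension of a sequence. -/
noncomputable def dimFSSeq {α : Type} [Fintype α] (S : ℕ → α) : ℝ≥0∞ :=
  dimFSSeqSet {S}

/-! Gambling and describing are compared on blocks of a large length `m`. Side information about a
block (a state, an account, a length, a carry) takes a header of `t = O(log m)` digits, and `t / m`
can be made arbitrarily small.

From a gambler to a transducer: by fairness, the growth factors of the `b ^ m` blocks from a given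
state sum to `b ^ m`, so at most `b ^ ℓ` blocks grow by `b ^ (m - ℓ)` or more. Such a block is coded
by an index of `ℓ` digits behind a header naming state, account and `ℓ`. Capital gained becomes
input saved (`FSGambler.exists_FST`), and the decoded prefixes of the expansion approximate `x`.

From a transducer to a gambler: the bets follow a mixture, over states, pending outputs and lengths,
of the images of uniformly random inputs. A block produced by `l` input digits then has probability
at least `b ^ (-(t + l))`, and these bounds multiply along the sequence. The obstacle is that a
string close to `x` need not share digits with `x`, as with 0.0999 and 0.1000. However, the integer
parts of `b ^ k * x` and `b ^ k * y` differ by at most 1 at the relevant precisions, so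
corresponding blocks, read as integers, differ by -1, 0 or 1 modulo `b ^ m` (`exists_shiftedBlock`).
Mixing over these three shifts costs a constant factor per block.

Neither construction depends on `x`, so both work uniformly on sets; a single point is the case of a
singleton. -/

/-! ### Blocks of a sequence -/

/-- The `j`-th block of length `m` of the sequence `S`. -/
def seqBlock {α : Type} (S : ℕ → α) (m j : ℕ) : Fin m → α :=
  fun i => S (j * m + i)

theorem length_seqPrefix {α : Type} (S : ℕ → α) (n : ℕ) : (seqPrefix S n).length = n := by
  simp [seqPrefix]

theorem seqPrefix_add {α : Type} (S : ℕ → α) (m n : ℕ) :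
    seqPrefix S (m + n) = seqPrefix S m ++ List.ofFn (fun i : Fin n => S (m + i)) := by
  simp only [seqPrefix, List.ofFn_add]
  rfl

theorem seqPrefix_succ_mul {α : Type} (S : ℕ → α) (m N : ℕ) :
    seqPrefix S ((N + 1) * m) = seqPrefix S (N * m) ++ List.ofFn (seqBlock S m N) := by
  rw [add_mul, one_mul, seqPrefix_add]
  rfl

/-! ### Transducers that decode prefix codes -/

theorem FST.outFrom_append {α : Type} (T : FST α) (q : T.Q) (v w : List α) :
    T.outFrom q (v ++ w) = T.outFrom q v ++ T.outFrom (T.run q v) w := by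
  induction v generalizing q with
  | nil => simp [FST.outFrom, FST.run]
  | cons c v ih => simp [FST.outFrom, FST.run, ih]

/-- A finite prefix code is decoded by a finite-state transducer. -/
theorem exists_FST_decoding {α U : Type} [Finite α] [Finite U] (e o : U → List α)
    (hne : ∀ u, e u ≠ []) (hpre : ∀ u u', e u <+: e u' → u = u') :
    ∃ T : FST α, ∀ l : List U, T.eval (l.flatMap e) = l.flatMap o := by
  classical
  obtain ⟨N, hN⟩ : ∃ N, ∀ u, (e u).length ≤ N := by
    obtain ⟨N, hN⟩ := (Set.finite_range fun u => (e u).length).bddAbove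
    exact ⟨N, fun u => hN ⟨u, rfl⟩⟩
  -- The state is the part of the current codeword read so far. The reset on overlong strings only
  -- keeps the state set finite; it is never used on concatenated codewords.
  let T : FST α :=
    { Q := {v : List α // v.length ≤ N}
      finite := (List.finite_length_le α N).to_subtype
      step := fun v a =>
        if h : (∃ u, e u = v.1 ++ [a]) ∨ ¬ (v.1 ++ [a]).length ≤ N then ⟨[], Nat.zero_le _⟩
        else ⟨v.1 ++ [a], by tauto⟩
      out := fun v a => if h : ∃ u, e u = v.1 ++ [a] then o h.choose else []
      start := ⟨[], Nat.zero_le _⟩ }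
  have key : ∀ (u : U) (w : List α) (v : T.Q), v.1 ++ w = e u → w ≠ [] →
      T.outFrom v w = o u ∧ T.run v w = T.start := by
    intro u w
    induction w with
    | nil => intro v _ h; exact absurd rfl h
    | cons a w ih =>
      intro v hv _
      by_cases hw : w = []
      · subst hw
        have h : ∃ u, e u = v.1 ++ [a] := ⟨u, hv.symm⟩
        have hu : h.choose = u := hpre _ _ (by rw [h.choose_spec, hv])
        have hout : T.out v a = o u := by
          change (if h : ∃ u, e u = v.1 ++ [a] then o h.choose else []) = o u
          rw [dif_pos h, hu]
        have hstep : T.step v a = T.start := dif_pos (Or.inl h)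
        simp [FST.outFrom, FST.run, hout, hstep]
      · have happ : v.1 ++ [a] ++ w = e u := by simpa using hv
        have h : ¬ ∃ u, e u = v.1 ++ [a] := by
          rintro ⟨u', hu'⟩
          have h1 : u' = u := hpre _ _ (by rw [hu', ← happ]; exact List.prefix_append _ _)
          have h2 := congrArg List.length happ
          rw [← hu', h1, List.length_append] at h2
          exact hw (List.length_eq_zero_iff.1 (by omega))
        have hlen : (v.1 ++ [a]).length ≤ N := by
          refine le_trans ?_ (hN u)
          rw [← happ]
          simp
        have hout : T.out v a = [] := dif_neg h
        have hstep : T.step v a = ⟨v.1 ++ [a], hlen⟩ := dif_neg (by tauto)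
        have := ih ⟨v.1 ++ [a], hlen⟩ happ hw
        simpa [FST.outFrom, FST.run, hout, hstep] using this
  refine ⟨T, fun l => ?_⟩
  have hl : T.outFrom T.start (l.flatMap e) = l.flatMap o := by
    induction l with
    | nil => rfl
    | cons u l ih =>
      obtain ⟨h1, h2⟩ := key u (e u) T.start rfl (hne u)
      rw [List.flatMap_cons, List.flatMap_cons, FST.outFrom_append, h1, h2, ih]
  exact hl

/-- A prefix code whose words consist of a header of length `t` that specifies a key and an index
among the elements with this key. -/
theorem exists_prefixCode {b : ℕ} {U H : Type} [Finite U] [Finite H] (key : U → H) (ℓ : H → ℕ)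
    (t : ℕ) (hH : Nat.card H ≤ b ^ t) (hU : ∀ h, Nat.card {u // key u = h} ≤ b ^ ℓ h) :
    ∃ e : U → List (Fin b), (∀ u, (e u).length = t + ℓ (key u)) ∧
      ∀ u u', e u <+: e u' → u = u' := by
  have emb : ∀ (X : Type) [Finite X] (n : ℕ), Nat.card X ≤ b ^ n →
      Nonempty (X ↪ (Fin n → Fin b)) := by
    intro X _ n hX
    have := Fintype.ofFinite X
    refine Function.Embedding.nonempty_of_card_le ?_
    rw [← Nat.card_eq_fintype_card]
    simpa using hX
  obtain ⟨hd⟩ := emb H t hH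
  have idx : ∀ h, {u // key u = h} ↪ (Fin (ℓ h) → Fin b) := fun h => (emb _ _ (hU h)).some
  refine ⟨fun u => List.ofFn (hd (key u)) ++ List.ofFn (idx (key u) ⟨u, rfl⟩), fun u => by simp,
    fun u u' h => ?_⟩
  have hkey : key u = key u' := by
    have h1 := List.prefix_append (List.ofFn (hd (key u))) (List.ofFn (idx (key u) ⟨u, rfl⟩))
    have h2 := List.prefix_append (List.ofFn (hd (key u'))) (List.ofFn (idx (key u') ⟨u', rfl⟩))
    have h3 := List.prefix_of_prefix_length_le (h1.trans h) h2 (by simp)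
    exact hd.injective (List.ofFn_injective (h3.eq_of_length (by simp)))
  -- The type of the index depends on the key, so the keys are made variables before they are
  -- identified.
  have gen : ∀ k k' (hk : key u = k) (hk' : key u' = k'), k = k' →
      List.ofFn (hd k) ++ List.ofFn (idx k ⟨u, hk⟩) <+:
        List.ofFn (hd k') ++ List.ofFn (idx k' ⟨u', hk'⟩) → u = u' := by
    rintro k _ hk hk' rfl h
    have h1 := h.eq_of_length (by simp)
    have h2 := List.ofFn_injective (List.append_cancel_left h1)
    exact congrArg Subtype.val ((idx k).injective h2)
  exact gen _ _ rfl rfl hkey h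

/-! ### Gamblers on blocks -/

namespace FSGambler

variable {α : Type} [Fintype α]

theorem growth_append (G : FSGambler α) (i : Fin G.accounts) (q : G.Q) (v w : List α) :
    G.growth i q (v ++ w) = G.growth i q v * G.growth i (G.run q v) w := by
  induction v generalizing q with
  | nil => simp [growth, run]
  | cons c v ih => simp [growth, run, ih, mul_assoc]

theorem run_append (G : FSGambler α) (q : G.Q) (v w : List α) :
    G.run q (v ++ w) = G.run (G.run q v) w := by
  simp [run]

/-- Fairness of the bets. It serves both as a counting bound for blocks of large growth and as the
bound `|α| ^ m` for a single block. -/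
theorem sum_growth (G : FSGambler α) (i : Fin G.accounts) (m : ℕ) (q : G.Q) :
    ∑ u : Fin m → α, G.growth i q (List.ofFn u) = (Fintype.card α : ℚ≥0) ^ m := by
  induction m generalizing q with
  | zero => simp [growth]
  | succ m ih =>
    rw [← (Fin.consEquiv fun _ => α).sum_comp, Fintype.sum_prod_type]
    simp only [Fin.consEquiv_apply, List.ofFn_succ, Fin.cons_zero, Fin.cons_succ, growth,
      ← Finset.mul_sum, ih]
    rw [← Finset.sum_mul, ← Finset.mul_sum, G.bet_sum, mul_one, pow_succ']

end FSGambler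

/-! ### Compression of the blocks on which a gambler wins -/

namespace FSGambler

/-- The integral code length, at most `m`, of a block of `m` symbols on which an account grows by
the factor `g`. -/
theorem exists_codeLength {b : ℕ} (hb : 1 ≤ b) (m : ℕ) (g : ℚ≥0) (hg : g ≤ (b : ℚ≥0) ^ m) :
    ∃ ℓ : Fin (m + 1), ((ℓ : ℕ) = m ∨ (b : ℚ≥0) ^ m ≤ b ^ (ℓ : ℕ) * g) ∧
      (b : ℚ≥0) ^ (ℓ : ℕ) * g ≤ b ^ (m + 1) := by
  have hb' : (1 : ℚ≥0) ≤ b := by exact_mod_cast hb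
  have hex : ∃ ℓ : ℕ, ℓ = m ∨ (b : ℚ≥0) ^ m ≤ b ^ ℓ * g := ⟨m, Or.inl rfl⟩
  classical
  refine ⟨⟨Nat.find hex, Nat.lt_succ_of_le (Nat.find_min' hex (Or.inl rfl))⟩, Nat.find_spec hex, ?_⟩
  change (b : ℚ≥0) ^ Nat.find hex * g ≤ _
  rcases hn : Nat.find hex with _ | n
  · simpa using hg.trans (pow_le_pow_right₀ hb' (Nat.le_succ m))
  -- By minimality the level `n` fails, so rounding up to an integral length costs at most one
  -- factor `b`.
  · have h := Nat.find_min hex (m := n) (by omega)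
    push Not at h
    calc (b : ℚ≥0) ^ (n + 1) * g = b * (b ^ n * g) := by ring
      _ ≤ b * b ^ m := by gcongr; exact h.2.le
      _ = b ^ (m + 1) := by ring

/-- A transducer that compresses the prefixes of a sequence on which an account of the gambler
wins. -/
theorem exists_FST {b : ℕ} (hb : 1 ≤ b) (G : FSGambler (Fin b)) (m t : ℕ) (ht : 0 < t)
    (hcard : Nat.card G.Q * G.accounts * (m + 1) ≤ b ^ t) :
    ∃ T : FST (Fin b), ∀ (S : ℕ → Fin b) (i : Fin G.accounts) (N : ℕ), ∃ p : List (Fin b),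
      T.eval p = seqPrefix S (N * m) ∧
      (b : ℚ≥0) ^ p.length * G.growth i G.start (seqPrefix S (N * m)) ≤
        b ^ ((t + m + 1) * N) := by
  have := G.finite
  have hb0 : (0 : ℚ≥0) < b := by exact_mod_cast hb
  have hle : ∀ (q : G.Q) (i : Fin G.accounts) (u : Fin m → Fin b),
      G.growth i q (List.ofFn u) ≤ (b : ℚ≥0) ^ m := by
    intro q i u
    have h := G.sum_growth i m q
    rw [Fintype.card_fin] at h
    rw [← h]
    exact Finset.single_le_sum (f := fun u : Fin m → Fin b => G.growth i q (List.ofFn u))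
      (fun _ _ => zero_le) (Finset.mem_univ u)
  choose lev hlev1 hlev2 using fun q i u => exists_codeLength hb m _ (hle q i u)
  let U : Type := G.Q × Fin G.accounts × (Fin m → Fin b)
  let key : U → G.Q × Fin G.accounts × Fin (m + 1) := fun u => (u.1, u.2.1, lev u.1 u.2.1 u.2.2)
  -- Markov's inequality: below level `m`, each block counted has growth at least `b ^ (m - ℓ)`,
  -- while all growths sum to `b ^ m`. At level `m` the bound is trivial.
  have hlevel : ∀ h, Nat.card {u : U // key u = h} ≤ b ^ (h.2.2 : ℕ) := by
    classical
    rintro ⟨q, i, ℓ⟩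
    let F : Finset (Fin m → Fin b) := Finset.univ.filter fun u => lev q i u = ℓ
    have hinj : Nat.card {u : U // key u = (q, i, ℓ)} ≤ F.card := by
      rw [← Nat.card_eq_finsetCard F]
      refine Nat.card_le_card_of_injective (β := F) (fun u => ⟨u.1.2.2, ?_⟩) ?_
      · obtain ⟨⟨q', i', u⟩, hu⟩ := u
        obtain ⟨rfl, rfl, hlev⟩ : q' = q ∧ i' = i ∧ lev q' i' u = ℓ := by simpa [key] using hu
        simpa [F] using hlev
      · rintro ⟨⟨q', i', u⟩, hu⟩ ⟨⟨q'', i'', u'⟩, hu'⟩ h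
        simp only [key, Prod.mk.injEq] at hu hu'
        simp only [Subtype.mk.injEq] at h
        simp [hu.1, hu.2.1, hu'.1, hu'.2.1, h]
    refine hinj.trans ?_
    by_cases hm : (ℓ : ℕ) = m
    · refine (Finset.card_le_univ F).trans ?_
      simp [hm]
    · have h1 : (F.card : ℚ≥0) * b ^ m ≤ b ^ (ℓ : ℕ) * b ^ m :=
        calc (F.card : ℚ≥0) * b ^ m = ∑ u ∈ F, (b : ℚ≥0) ^ m := by simp
          _ ≤ ∑ u ∈ F, b ^ (ℓ : ℕ) * G.growth i q (List.ofFn u) := by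
            refine Finset.sum_le_sum fun u hu => ?_
            have hu' : lev q i u = ℓ := by simpa [F] using hu
            rw [← hu'] at hm ⊢
            exact (hlev1 q i u).resolve_left hm
          _ ≤ ∑ u, b ^ (ℓ : ℕ) * G.growth i q (List.ofFn u) :=
            Finset.sum_le_sum_of_subset (Finset.subset_univ _)
          _ = b ^ (ℓ : ℕ) * b ^ m := by
            rw [← Finset.mul_sum, G.sum_growth, Fintype.card_fin]
      have h2 := le_of_mul_le_mul_right h1 (pow_pos hb0 m)
      exact_mod_cast h2
  obtain ⟨e, hlen, hpre⟩ := exists_prefixCode key (fun h => (h.2.2 : ℕ)) t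
    (by simpa [Nat.card_prod, mul_assoc] using hcard) hlevel
  obtain ⟨T, hT⟩ := exists_FST_decoding e (fun u : U => List.ofFn u.2.2)
    (fun u h => by have := hlen u; rw [h] at this; simp at this; omega) hpre
  refine ⟨T, fun S i N => ?_⟩
  suffices h : ∃ l : List U, (l.flatMap fun u : U => List.ofFn u.2.2) = seqPrefix S (N * m) ∧
      (b : ℚ≥0) ^ (l.flatMap e).length * G.growth i G.start (seqPrefix S (N * m)) ≤
        b ^ ((t + m + 1) * N) by
    obtain ⟨l, h1, h2⟩ := h
    exact ⟨l.flatMap e, (hT l).trans h1, h2⟩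
  induction N with
  | zero => exact ⟨[], by simp [seqPrefix], by simp [seqPrefix, growth]⟩
  | succ N ih =>
    obtain ⟨l, h1, h2⟩ := ih
    -- The header carries the gambler's state at the block's start, so the decoder need not simulate
    -- the gambler.
    let q := G.run G.start (seqPrefix S (N * m))
    refine ⟨l ++ [(q, i, seqBlock S m N)], ?_, ?_⟩
    · rw [seqPrefix_succ_mul, List.flatMap_append, h1]
      simp
    · rw [seqPrefix_succ_mul, growth_append, List.flatMap_append, List.length_append]
      have h3 := hlev2 q i (seqBlock S m N)
      have h4 : (List.flatMap e [(q, i, seqBlock S m N)]).length =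
          t + (lev q i (seqBlock S m N) : ℕ) := by simp [hlen, key]
      rw [h4]
      calc _ = ((b : ℚ≥0) ^ (l.flatMap e).length * G.growth i G.start (seqPrefix S (N * m))) *
            (b ^ t * (b ^ (lev q i (seqBlock S m N) : ℕ) *
              G.growth i q (List.ofFn (seqBlock S m N)))) := by ring
        _ ≤ b ^ ((t + m + 1) * N) * (b ^ t * b ^ (m + 1)) := by gcongr
        _ = _ := by ring

end FSGambler

/-! ### Small header cost, and the dimension of reals bounded by that of sequences -/

theorem exists_block_params {b : ℕ} (hb : 2 ≤ b) (c : ℕ) {ε : ℝ} (hε : 0 < ε) :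
    ∃ m t : ℕ, 0 < m ∧ 0 < t ∧ c * (m + 1) ≤ b ^ t ∧ (t + 1 : ℝ) ≤ ε * m := by
  have hb1 : (1 : ℝ) < b := by exact_mod_cast hb
  have h1 : Tendsto (fun k : ℕ => (k : ℝ) ^ 1 / (b : ℝ) ^ k) atTop (𝓝 0) :=
    tendsto_pow_const_div_const_pow_of_one_lt 1 hb1
  have h2 : Tendsto (fun k : ℕ => (c + 2 : ℝ) / (b : ℝ) ^ k) atTop (𝓝 0) :=
    tendsto_const_nhds.div_atTop (tendsto_pow_atTop_atTop_of_one_lt hb1)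
  have h3 := h1.add h2
  rw [add_zero] at h3
  obtain ⟨k, hk⟩ := (h3.eventually (gt_mem_nhds hε)).exists
  -- With `m` a power of `b`, a header of logarithmic length suffices: `c ≤ b ^ c` and `m + 1 ≤ b ^
  -- (k + 1)`.
  refine ⟨b ^ k, k + c + 1, by positivity, by omega, ?_, ?_⟩
  · have hc : c ≤ b ^ c := (Nat.lt_pow_self hb).le
    have h4 : b ^ k + 1 ≤ b ^ (k + 1) := by
      have h5 : 1 ≤ b ^ k := Nat.one_le_pow _ _ (by omega)
      rw [pow_succ]
      nlinarith
    calc c * (b ^ k + 1) ≤ b ^ c * b ^ (k + 1) := Nat.mul_le_mul hc h4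
      _ = b ^ (k + c + 1) := by ring
  · have hp : (0 : ℝ) < (b : ℝ) ^ k := by positivity
    rw [← add_div, div_lt_iff₀ hp] at hk
    push_cast
    linarith

theorem abs_realOfStr_seqPrefix_sub_le {b : ℕ} [NeZero b] (hb : 2 ≤ b) {x : ℝ}
    (hx : x ∈ Set.Ico (0 : ℝ) 1) (n : ℕ) :
    |realOfStr (seqPrefix (seqOfReal b x) n) - x| ≤ ((b : ℝ) ^ n)⁻¹ := by
  have h := Real.abs_ofDigits_sub_ofDigits_le (n := n)
    (x := fun i => (seqPrefix (seqOfReal b x) n).getD i 0) (y := Real.digits x b)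
    fun i hi => by simp [seqPrefix, hi, seqOfReal]
  rwa [Real.ofDigits_digits hb hx] at h

theorem FST.KReal_le_length {b : ℕ} [NeZero b] (T : FST (Fin b)) {δ x : ℝ} (p : List (Fin b))
    (h : |realOfStr (T.eval p) - x| < δ) : T.KReal δ x ≤ p.length :=
  (iInf₂_le (T.eval p) h).trans 
    (iInf₂_le (f := fun q (_ : T.eval q = T.eval p) => (q.length : ℕ∞)) p rfl)

namespace FSGambler

theorem Succeeds.frequently_one_le {α : Type} [Fintype α] {G : FSGambler α} {s : ℝ≥0}
    {S : ℕ → α} (h : G.Succeeds s S) : ∃ᶠ n in atTop, 1 ≤ G.gale s (seqPrefix S n) := by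
  have h1 : (1 : ℝ≥0∞) < limsup (fun n : ℕ => ENNReal.ofReal (G.gale s (seqPrefix S n))) atTop := by
    rw [h]
    exact ENNReal.one_lt_top
  refine (frequently_lt_of_lt_limsup (by isBoundedDefault) h1).mono fun n hn => ?_
  exact (ENNReal.one_lt_ofReal.1 hn).le

/-- Up to a constant factor, the martingale on a prefix is at most the growth of one of the
accounts on the longest prefix that consists of full blocks. -/
theorem exists_martingale_le {b : ℕ} (hb : 1 ≤ b) (G : FSGambler (Fin b)) {m : ℕ} (hm : 0 < m)
    (S : ℕ → Fin b) (n : ℕ) :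
    ∃ i, G.martingale (seqPrefix S n) ≤
      (∑ i, G.initCapital i) * (G.growth i G.start (seqPrefix S (n / m * m)) * b ^ m) := by
  have : Nonempty (Fin G.accounts) := ⟨⟨0, G.accounts_pos⟩⟩
  have hb' : (1 : ℚ≥0) ≤ b := by exact_mod_cast hb
  obtain ⟨i, -, hi⟩ := Finset.exists_max_image Finset.univ
    (fun i => G.growth i G.start (seqPrefix S (n / m * m))) Finset.univ_nonempty
  refine ⟨i, ?_⟩
  rw [martingale, Finset.sum_mul]
  refine Finset.sum_le_sum fun j _ => ?_
  rw [account]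
  refine mul_le_mul_right ?_ _
  have hn : n = n / m * m + n % m := by rw [mul_comm]; exact (Nat.div_add_mod n m).symm
  have h1 : seqPrefix S n = seqPrefix S (n / m * m) ++
      List.ofFn (fun i : Fin (n % m) => S (n / m * m + i)) := by
    rw [← seqPrefix_add, ← hn]
  rw [h1, growth_append]
  refine mul_le_mul' (hi j (Finset.mem_univ j)) ?_
  have h2 := G.sum_growth j (n % m) (G.run G.start (seqPrefix S (n / m * m)))
  rw [Fintype.card_fin] at h2
  refine le_trans ?_ (pow_le_pow_right₀ hb' (Nat.mod_lt n hm).le)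
  rw [← h2]
  exact Finset.single_le_sum (f := fun u : Fin (n % m) → Fin b => G.growth j _ (List.ofFn u))
    (fun _ _ => zero_le) (Finset.mem_univ _)

/-- The length of the compressed prefix of a sequence at a moment at which the gambler has not lost
capital. -/
theorem length_le_of_one_le_gale {b : ℕ} (hb : 2 ≤ b) {G : FSGambler (Fin b)} {m t κ : ℕ}
    (hm : 0 < m) (hκ : ∑ i, G.initCapital i ≤ (b : ℚ≥0) ^ κ) {s : ℝ≥0} {S : ℕ → Fin b} {n : ℕ}
    (hn : 1 ≤ G.gale s (seqPrefix S n)) :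
    ∃ i, ∀ l : ℕ, (b : ℚ≥0) ^ l * G.growth i G.start (seqPrefix S (n / m * m)) ≤
        b ^ ((t + m + 1) * (n / m)) →
      (l : ℝ) ≤ s * ((n / m : ℕ) * m) + (t + 1) * (n / m : ℕ) + ((s + 1) * m + κ) := by
  obtain ⟨i, hi⟩ := G.exists_martingale_le (by omega) hm S n
  refine ⟨i, fun l hl => ?_⟩
  have hb0 : (0 : ℝ) < b := by positivity
  have hb1 : (1 : ℝ) < b := by exact_mod_cast hb
  have h1 : (b : ℚ≥0) ^ l * G.martingale (seqPrefix S n) ≤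
      b ^ (κ + m + (t + m + 1) * (n / m)) :=
    calc (b : ℚ≥0) ^ l * G.martingale (seqPrefix S n)
        ≤ b ^ l * ((∑ i, G.initCapital i) *
          (G.growth i G.start (seqPrefix S (n / m * m)) * b ^ m)) := by gcongr
      _ = (∑ i, G.initCapital i) * b ^ m *
          (b ^ l * G.growth i G.start (seqPrefix S (n / m * m))) := by ring
      _ ≤ b ^ κ * b ^ m * b ^ ((t + m + 1) * (n / m)) := by gcongr
      _ = _ := by ring
  have h2 : (b : ℝ) ^ l * ((G.martingale (seqPrefix S n) : ℚ≥0) : ℝ) ≤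
      (b : ℝ) ^ (κ + m + (t + m + 1) * (n / m)) := by exact_mod_cast h1
  rw [gale, Fintype.card_fin, length_seqPrefix] at hn
  have h3 : (b : ℝ) ^ (l : ℝ) ≤
      (b : ℝ) ^ (((s : ℝ) - 1) * n + (κ + m + (t + m + 1) * (n / m) : ℕ)) := by
    rw [Real.rpow_add hb0, Real.rpow_natCast, Real.rpow_natCast]
    calc (b : ℝ) ^ l ≤ (b : ℝ) ^ l * ((b : ℝ) ^ (((s : ℝ) - 1) * n) *
          ((G.martingale (seqPrefix S n) : ℚ≥0) : ℝ)) := le_mul_of_one_le_right (by positivity) hn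
      _ = (b : ℝ) ^ (((s : ℝ) - 1) * n) *
          ((b : ℝ) ^ l * ((G.martingale (seqPrefix S n) : ℚ≥0) : ℝ)) := by ring
      _ ≤ _ := by gcongr
  -- The sign of `s - 1` is unknown: `s * n` is bounded through `n ≤ (n / m) * m + m`, and `-n`
  -- through `(n / m) * m ≤ n`.
  have h4 := (Real.rpow_le_rpow_left_iff hb1).1 h3
  have h5 : ((n / m : ℕ) * m : ℝ) ≤ n := by exact_mod_cast Nat.div_mul_le_self n m
  have h6 : (n : ℝ) ≤ (n / m : ℕ) * m + m := by
    have h7 : n ≤ n / m * m + m := by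
      have := Nat.div_add_mod n m
      have := Nat.mod_lt n hm
      rw [mul_comm]
      omega
    exact_mod_cast h7
  have h8 : (s : ℝ) * n ≤ s * ((n / m : ℕ) * m + m) := by gcongr
  generalize n / m = N at *
  push_cast at h4
  nlinarith

end FSGambler

theorem exists_FST_lowerRate_le {b : ℕ} [NeZero b] (hb : 2 ≤ b) (G : FSGambler (Fin b)) (s : ℝ≥0)
    {ε : ℝ≥0} (hε : 0 < ε) :
    ∃ T : FST (Fin b), ∀ x ∈ Set.Ico (0 : ℝ) 1, G.Succeeds s (seqOfReal b x) →
      T.lowerRate x ≤ (s + ε : ℝ≥0) := by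
  have hε2 : (0 : ℝ) < ε / 2 := by positivity
  obtain ⟨m, t, hm, ht, hc, hmt⟩ := exists_block_params hb (Nat.card G.Q * G.accounts) hε2
  obtain ⟨T, hT⟩ := G.exists_FST (by omega) m t ht hc
  refine ⟨T, fun x hx hS => ?_⟩
  set S := seqOfReal b x with hSdef
  have hb0 : (0 : ℝ) < b := by positivity
  have hb1 : (1 : ℝ) < b := by exact_mod_cast hb
  have hb1' : (1 : ℚ≥0) < b := by exact_mod_cast hb
  obtain ⟨κ, hκ⟩ := pow_unbounded_of_one_lt (∑ i, G.initCapital i) hb1'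
  have hN : Tendsto (fun n : ℕ => n / m * m) atTop atTop := by
    refine tendsto_atTop_mono (f := fun n => n - m) (fun n => ?_) (tendsto_sub_atTop_nat m)
    have := Nat.div_add_mod n m
    have := Nat.mod_lt n hm
    rw [mul_comm]
    omega
  -- The extra factor `b` makes the truncation error strictly smaller than the precision and lowers
  -- its logarithm by only 1.
  have hδ : Tendsto (fun n : ℕ => (b : ℝ) * ((b : ℝ) ^ (n / m * m))⁻¹) atTop (𝓝[>] 0) := by
    refine tendsto_nhdsWithin_iff.2 ⟨?_, Eventually.of_forall fun n => Set.mem_Ioi.2 (by positivity)⟩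
    have h := (tendsto_inv_atTop_zero.comp
      ((tendsto_pow_atTop_atTop_of_one_lt hb1).comp hN)).const_mul (b : ℝ)
    simpa using h
  refine liminf_le_of_frequently_le' (hδ.frequently ?_)
  have hlarge : ∀ᶠ n : ℕ in atTop, ((s : ℝ) + 1) * m + κ + s + ε ≤ ε / 2 * ((n / m * m : ℕ) : ℝ) :=
    ((tendsto_natCast_atTop_atTop.comp hN).const_mul_atTop hε2).eventually_ge_atTop _
  refine (hS.frequently_one_le.and_eventually (hlarge.and (hN.eventually_ge_atTop 2))).mono ?_
  rintro n ⟨hn, hn1, hn2⟩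
  obtain ⟨i, hi⟩ := FSGambler.length_le_of_one_le_gale (t := t) hb hm hκ.le hn
  obtain ⟨p, hp, hlen⟩ := hT S i (n / m)
  have hl := hi _ hlen
  have hK : T.KReal (b * ((b : ℝ) ^ (n / m * m))⁻¹) x ≤ p.length := by
    refine T.KReal_le_length p ?_
    rw [hp]
    refine (abs_realOfStr_seqPrefix_sub_le hb hx _).trans_lt ?_
    exact lt_mul_of_one_lt_left (by positivity) hb1
  have hlog : Real.logb b (1 / (b * ((b : ℝ) ^ (n / m * m))⁻¹)) = ((n / m * m : ℕ) : ℝ) - 1 := by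
    rw [one_div, mul_inv, inv_inv, Real.logb_mul (by positivity) (by positivity), Real.logb_inv,
      Real.logb_self_eq_one hb1, Real.logb_pow, Real.logb_self_eq_one hb1]
    ring
  rw [hlog]
  refine ENNReal.div_le_of_le_mul ?_
  have hK' : (T.KReal (b * ((b : ℝ) ^ (n / m * m))⁻¹) x : ℝ≥0∞) ≤ (p.length : ℝ≥0∞) := by
    have := ENat.toENNReal_le.2 hK
    simpa using this
  refine hK'.trans ?_
  rw [← ENNReal.ofReal_natCast, ← ENNReal.ofReal_coe_nnreal, ← ENNReal.ofReal_mul (by positivity)]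
  refine ENNReal.ofReal_le_ofReal ?_
  have h1 : ((t : ℝ) + 1) * (n / m : ℕ) ≤ ε / 2 * m * (n / m : ℕ) := by gcongr
  push_cast at hn1 hl h1 ⊢
  generalize ((n / m : ℕ) : ℝ) = N at *
  nlinarith

theorem dimFSRealSet_le_dimFSSeqSet {b : ℕ} [NeZero b] (hb : 2 ≤ b) {A : Set ℝ}
    (hA : A ⊆ Set.Ico (0 : ℝ) 1) : dimFSRealSet b A ≤ dimFSSeqSet (seqOfReal b '' A) := by
  refine le_iInf₂ fun s ⟨G, hG⟩ => ?_
  refine ENNReal.le_of_forall_pos_le_add fun ε hε _ => ?_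
  obtain ⟨T, hT⟩ := exists_FST_lowerRate_le hb G s hε
  refine (iInf_le _ T).trans (iSup₂_le fun x hx => ?_)
  simpa using hT x (hA hx) (hG _ ⟨x, hx, rfl⟩)

/-! ### Gamblers that bet on blocks -/

section BlockMeasure

variable {α : Type} [Fintype α] [DecidableEq α] {m : ℕ}

/-- The probability that a random block has the prefix `v`. -/
def prefixWeight (ω : (Fin m → α) → ℚ≥0) (v : List α) : ℚ≥0 :=
  ∑ u, if (List.ofFn u).take v.length = v then ω u else 0

theorem prefixWeight_nil (ω : (Fin m → α) → ℚ≥0) : prefixWeight ω [] = ∑ u, ω u := by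
  simp [prefixWeight]

theorem prefixWeight_ofFn (ω : (Fin m → α) → ℚ≥0) (u : Fin m → α) :
    prefixWeight ω (List.ofFn u) = ω u := by
  have h : ∀ u' : Fin m → α,
      (List.ofFn u').take (List.ofFn u).length = List.ofFn u ↔ u = u' := by
    intro u'
    rw [List.take_of_length_le (by simp), List.ofFn_inj, eq_comm]
  simp only [prefixWeight, h, Finset.sum_ite_eq, Finset.mem_univ, if_true]

theorem sum_prefixWeight_concat (ω : (Fin m → α) → ℚ≥0) {v : List α} (hv : v.length < m) :
    ∑ a, prefixWeight ω (v ++ [a]) = prefixWeight ω v := by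
  simp only [prefixWeight]
  rw [Finset.sum_comm]
  refine Finset.sum_congr rfl fun u _ => ?_
  have h : ∀ a, (List.ofFn u).take (v ++ [a]).length = v ++ [a] ↔
      (List.ofFn u).take v.length = v ∧ u ⟨v.length, hv⟩ = a := by
    intro a
    rw [List.length_append, List.length_singleton, List.take_succ_eq_append_getElem (by simpa),
      List.append_singleton_inj, List.getElem_ofFn]
  simp only [h, ite_and]
  split_ifs <;> simp

theorem prefixWeight_pos [Nonempty α] (ω : (Fin m → α) → ℚ≥0) (hpos : ∀ u, 0 < ω u) {v : List α}
    (hv : v.length ≤ m) : 0 < prefixWeight ω v := by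
  obtain ⟨a⟩ := ‹Nonempty α›
  have h : (List.ofFn fun i : Fin m => v.getD i a).take v.length = v := by
    refine List.ext_getElem (by simpa) fun i h1 h2 => ?_
    simp [h2]
  refine lt_of_lt_of_le (hpos fun i : Fin m => v.getD i a) ?_
  refine le_trans (by rw [if_pos h]) (Finset.single_le_sum
    (f := fun u : Fin m → α => if (List.ofFn u).take v.length = v then ω u else 0)
    (fun _ _ => zero_le) (Finset.mem_univ fun i : Fin m => v.getD i a))

/-- A gambler that bets on successive blocks of length `m` according to a given probability
measure. -/
theorem exists_FSGambler_of_blockMeasure [Nonempty α] (hm : 0 < m) (ω : (Fin m → α) → ℚ≥0)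
    (hpos : ∀ u, 0 < ω u) (hsum : ∑ u, ω u = 1) :
    ∃ G : FSGambler α, ∀ (S : ℕ → α) (N : ℕ), G.martingale (seqPrefix S (N * m)) =
      ∏ j ∈ Finset.range N, (Fintype.card α : ℚ≥0) ^ m * ω (seqBlock S m j) := by
  let G : FSGambler α :=
    { Q := {v : List α // v.length < m}
      finite := (List.finite_length_lt α m).to_subtype
      step := fun v a => if h : (v.1 ++ [a]).length < m then ⟨v.1 ++ [a], h⟩ else ⟨[], hm⟩
      start := ⟨[], hm⟩
      accounts := 1
      accounts_pos := one_pos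
      -- Conditional probabilities given the part of the block already read; over a full block their
      -- product telescopes to `ω`.
      bet := fun v _ a => prefixWeight ω (v.1 ++ [a]) / prefixWeight ω v.1
      bet_sum := fun v _ => by
        rw [← Finset.sum_div, sum_prefixWeight_concat ω v.2]
        exact div_self (prefixWeight_pos ω hpos v.2.le).ne'
      initCapital := fun _ => 1 }
  have key : ∀ (i : Fin G.accounts) (u : Fin m → α) (w : List α) (v : G.Q),
      v.1 ++ w = List.ofFn u → w ≠ [] →
      G.growth i v w * prefixWeight ω v.1 = (Fintype.card α : ℚ≥0) ^ w.length * ω u ∧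
        G.run v w = G.start := by
    intro i u w
    induction w with
    | nil => intro v _ h; exact absurd rfl h
    | cons a w ih =>
      intro v hv _
      have hw0 : prefixWeight ω v.1 ≠ 0 := (prefixWeight_pos ω hpos v.2.le).ne'
      have hbet : G.bet v i a = prefixWeight ω (v.1 ++ [a]) / prefixWeight ω v.1 := rfl
      by_cases hw : w = []
      · subst hw
        have hlen := congrArg List.length hv
        have hstep : G.step v a = G.start := dif_neg (by
          rw [List.length_append, List.length_ofFn] at hlen
          rw [List.length_append]
          simp only [List.length_cons, List.length_nil] at hlen ⊢
          omega)
        refine ⟨?_, by simp [FSGambler.run, hstep]⟩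
        simp only [FSGambler.growth, hbet, hv, prefixWeight_ofFn, List.length_cons, List.length_nil]
        field_simp
        ring
      · have happ : v.1 ++ [a] ++ w = List.ofFn u := by simpa using hv
        have hlen : (v.1 ++ [a]).length < m := by
          have h1 := congrArg List.length happ
          rw [List.length_append, List.length_ofFn] at h1
          have h2 := List.length_pos_iff.2 hw
          omega
        have hstep : G.step v a = ⟨v.1 ++ [a], hlen⟩ := dif_pos hlen
        obtain ⟨h1, h2⟩ := ih ⟨v.1 ++ [a], hlen⟩ happ hw
        refine ⟨?_, by simpa [FSGambler.run, hstep] using h2⟩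
        simp only [FSGambler.growth, hbet, hstep, List.length_cons]
        rw [pow_succ', mul_assoc (Fintype.card α : ℚ≥0) _ (ω u), ← h1]
        field_simp
  refine ⟨G, fun S N => ?_⟩
  have hprod : ∀ i : Fin G.accounts, G.growth i G.start (seqPrefix S (N * m)) =
        ∏ j ∈ Finset.range N, (Fintype.card α : ℚ≥0) ^ m * ω (seqBlock S m j) ∧
      G.run G.start (seqPrefix S (N * m)) = G.start := by
    intro i
    induction N with
    | zero => simp [seqPrefix, FSGambler.growth, FSGambler.run]
    | succ N ih =>
      obtain ⟨h1, h2⟩ := key i (seqBlock S m N) (List.ofFn (seqBlock S m N)) G.start rfl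
        (by rw [Ne, List.ofFn_eq_nil_iff]; omega)
      have h3 : prefixWeight ω G.start.1 = 1 := (prefixWeight_nil ω).trans hsum
      rw [h3, mul_one, List.length_ofFn] at h1
      rw [seqPrefix_succ_mul, FSGambler.growth_append, FSGambler.run_append, ih.2, ih.1, h1,
        Finset.prod_range_succ]
      exact ⟨rfl, h2⟩
  have hone : ∀ w, G.martingale w = G.account 0 w := fun w => Fin.sum_univ_one _
  rw [hone, FSGambler.account, (hprod 0).1]
  exact one_mul _

end BlockMeasure

/-- The mixture of the images of the uniform measures on strings of lengths `ℓ θ`. -/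
theorem exists_mixture {b : ℕ} (hb : 0 < b) {Θ W : Type} [Fintype Θ] [Nonempty Θ] [Fintype W]
    (ℓ : Θ → ℕ) (F : Θ → List (Fin b) → W) :
    ∃ ω : W → ℚ≥0, ∑ u, ω u = 1 ∧
      ∀ θ w, w.length = ℓ θ → 1 ≤ (Fintype.card Θ : ℚ≥0) * b ^ w.length * ω (F θ w) := by
  classical
  have hb0 : (0 : ℚ≥0) < b := by exact_mod_cast hb
  have hΘ : (0 : ℚ≥0) < Fintype.card Θ := by exact_mod_cast Fintype.card_pos
  let f : W → Θ → ℚ≥0 := fun u θ => ∑ w : Fin (ℓ θ) → Fin b,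
    if F θ (List.ofFn w) = u then ((Fintype.card Θ : ℚ≥0) * b ^ ℓ θ)⁻¹ else 0
  refine ⟨fun u => ∑ θ, f u θ, ?_, fun θ w hw => ?_⟩
  · rw [Finset.sum_comm]
    have h : ∀ θ, ∑ u, f u θ = (Fintype.card Θ : ℚ≥0)⁻¹ := by
      intro θ
      simp only [f]
      rw [Finset.sum_comm]
      simp only [Finset.sum_ite_eq, Finset.mem_univ, if_true, Finset.sum_const, Finset.card_univ,
        Fintype.card_fun, Fintype.card_fin, nsmul_eq_mul]
      have := pow_pos hb0 (ℓ θ)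
      push_cast
      field_simp
    simp [h, hΘ.ne']
  · obtain ⟨w', hw'⟩ : ∃ w' : Fin (ℓ θ) → Fin b, List.ofFn w' = w := by
      exact ⟨fun i => w.get (i.cast hw.symm), by
        refine List.ext_getElem (by simp [hw]) fun i h1 h2 => by simp⟩
    have h1 : ((Fintype.card Θ : ℚ≥0) * b ^ ℓ θ)⁻¹ ≤ f (F θ w) θ := by
      refine le_trans (by rw [hw', if_pos rfl]) (Finset.single_le_sum
        (f := fun w' : Fin (ℓ θ) → Fin b => if F θ (List.ofFn w') = F θ w then
          ((Fintype.card Θ : ℚ≥0) * b ^ ℓ θ)⁻¹ else 0) (fun _ _ => zero_le) (Finset.mem_univ w'))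
    have h2 : f (F θ w) θ ≤ ∑ θ', f (F θ w) θ' :=
      Finset.single_le_sum (fun _ _ => zero_le) (Finset.mem_univ θ)
    have h3 : (0 : ℚ≥0) < (Fintype.card Θ : ℚ≥0) * b ^ ℓ θ := by positivity
    rw [hw]
    calc (1 : ℚ≥0) = (Fintype.card Θ : ℚ≥0) * b ^ ℓ θ * ((Fintype.card Θ : ℚ≥0) * b ^ ℓ θ)⁻¹ :=
          (mul_inv_cancel₀ h3.ne').symm
      _ ≤ _ := by gcongr; exact h1.trans h2

/-! ### Blocks of the output of a transducer -/

theorem FST.exists_length_out_le {α : Type} [Finite α] (T : FST α) :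
    ∃ R, ∀ q a, (T.out q a).length ≤ R := by
  have := T.finite
  obtain ⟨R, hR⟩ := (Set.finite_range fun x : T.Q × α => (T.out x.1 x.2).length).bddAbove
  exact ⟨R, fun q a => hR ⟨(q, a), rfl⟩⟩

/-- The first `m` symbols of the output, padded by `c`, are produced by an initial piece of the
input, up to a bounded piece of output that is kept for the later blocks. -/
theorem FST.exists_chunk {α : Type} (T : FST α) {R : ℕ} (hR : ∀ q a, (T.out q a).length ≤ R)
    (c : α) (m : ℕ) (w : List α) (q : T.Q) (v : List α) (hv : v.length ≤ m + R) :
    ∃ w₁ w₂ v', w = w₁ ++ w₂ ∧ v'.length ≤ R ∧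
      (∀ i < m, (v ++ T.outFrom q w).getD i c = (v ++ T.outFrom q w₁).getD i c) ∧
      ∀ i, (v ++ T.outFrom q w).getD (i + m) c =
        (v' ++ T.outFrom (T.run q w₁) w₂).getD i c := by
  have hdrop : ∀ (l : List α) i, l.getD (i + m) c = (l.drop m).getD i c := by
    intro l i
    simp [List.getD_eq_getElem?_getD, add_comm]
  induction w generalizing q v with
  | nil =>
    refine ⟨[], [], v.drop m, rfl, by simp; omega, fun i _ => rfl, fun i => ?_⟩
    simp only [FST.outFrom, List.append_nil]
    exact hdrop v i
  | cons a w ih =>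
    -- Reading stops once `m` symbols are available. Before the last step fewer than `m` were
    -- pending, so at most `R` remain after the cut.
    by_cases hm : m ≤ v.length
    · refine ⟨[], a :: w, v.drop m, rfl, by simp; omega, fun i hi => ?_, fun i => ?_⟩
      · rw [List.getD_append _ _ _ _ (by omega), List.getD_append _ _ _ _ (by omega)]
      · rw [hdrop, List.drop_append_of_le_length hm]
        rfl
    · obtain ⟨w₁, w₂, v', h1, h2, h3, h4⟩ := ih (T.step q a) (v ++ T.out q a)
        (by have := hR q a; rw [List.length_append]; omega)
      refine ⟨a :: w₁, w₂, v', by simp [h1], h2, ?_, ?_⟩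
      · simpa [FST.outFrom] using h3
      · simpa [FST.outFrom, FST.run] using h4

/-- If a weight on blocks is large on all blocks that are near to blocks produced by a transducer,
then its product along a sequence of such blocks is large. -/
theorem FST.one_le_prod_of_near {b : ℕ} [NeZero b] (T : FST (Fin b)) {R : ℕ}
    (hR : ∀ q a, (T.out q a).length ≤ R) {m : ℕ} (ω : (Fin m → Fin b) → ℚ≥0) (D : ℚ≥0)
    (near : (Fin m → Fin b) → (Fin m → Fin b) → Prop)
    (hω : ∀ (q : T.Q) (v w : List (Fin b)) u, v.length ≤ R →
      near u (fun i => (v ++ T.outFrom q w).getD i 0) → 1 ≤ D * b ^ w.length * ω u)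
    (N : ℕ) (q : T.Q) (v w : List (Fin b)) (S : ℕ → Fin b) (hv : v.length ≤ R)
    (hS : ∀ j < N, near (seqBlock S m j)
      (seqBlock (fun i => (v ++ T.outFrom q w).getD i 0) m j)) :
    1 ≤ D ^ N * b ^ w.length * ∏ j ∈ Finset.range N, ω (seqBlock S m j) := by
  have hb1 : (1 : ℚ≥0) ≤ b := by exact_mod_cast NeZero.one_le
  induction N generalizing q v w S with
  | zero => simpa using one_le_pow₀ hb1
  | succ N ih =>
    obtain ⟨w₁, w₂, v', rfl, hv', h1, h2⟩ := T.exists_chunk hR 0 m w q v (by omega)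
    have hshift : ∀ (S : ℕ → Fin b) j, seqBlock S m (j + 1) = seqBlock (fun i => S (i + m)) m j := by
      intro S j
      funext i
      simp only [seqBlock]
      congr 1
      ring
    have h3 := ih (T.run q w₁) v' w₂ (fun i => S (i + m)) hv' fun j hj => by
      have h := hS (j + 1) (by omega)
      rw [hshift, hshift] at h
      simpa only [h2] using h
    have h4 : 1 ≤ D * b ^ w₁.length * ω (seqBlock S m 0) := by
      refine hω q v w₁ _ hv ?_
      have h := hS 0 (by omega)
      convert h using 1
      funext i
      simp only [seqBlock, zero_mul, zero_add]
      exact (h1 i i.2).symm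
    rw [Finset.prod_range_succ']
    simp only [hshift S]
    calc (1 : ℚ≥0) ≤ (D ^ N * b ^ w₂.length *
          ∏ j ∈ Finset.range N, ω (seqBlock (fun i => S (i + m)) m j)) *
          (D * b ^ w₁.length * ω (seqBlock S m 0)) := one_le_mul h3 h4
      _ = _ := by rw [List.length_append]; ring

/-! ### Values of blocks -/

/-- The number whose base-`b` digits, the most significant one first, form the block `u`. -/
def blockValue {b m : ℕ} (u : Fin m → Fin b) : ℕ :=
  finFunctionFinEquiv (u ∘ Fin.rev)

theorem blockValue_lt {b m : ℕ} (u : Fin m → Fin b) : blockValue u < b ^ m :=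
  (finFunctionFinEquiv (u ∘ Fin.rev)).2

theorem blockValue_injective {b m : ℕ} :
    Function.Injective (blockValue : (Fin m → Fin b) → ℕ) := by
  intro u v h
  have h1 := finFunctionFinEquiv.injective (Fin.ext h)
  funext i
  simpa using congrFun h1 i.rev

/-- The integer part of `b ^ k * x` is the integer written by the first `k` digits; appending a
block multiplies it by `b ^ m` and adds the block's value. -/
theorem floor_mul_add_blockValue {b : ℕ} [NeZero b] {x : ℝ} (hx : x ∈ Set.Ico (0 : ℝ) 1)
    (m j : ℕ) : ⌊(b : ℝ) ^ ((j + 1) * m) * x⌋₊ =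
      b ^ m * ⌊(b : ℝ) ^ (j * m) * x⌋₊ + blockValue (seqBlock (seqOfReal b x) m j) := by
  have hb0 : (b : ℝ) ≠ 0 := NeZero.ne _
  have h : (⌊(b : ℝ) ^ ((j + 1) * m) * x⌋₊ : ℝ) =
      (b : ℝ) ^ m * ⌊(b : ℝ) ^ (j * m) * x⌋₊ + blockValue (seqBlock (seqOfReal b x) m j) := by
    rw [← Real.ofDigits_digits_sum_eq hx, ← Real.ofDigits_digits_sum_eq hx, add_mul, one_mul,
      Finset.sum_range_add, mul_add, pow_add]
    congr 1
    · ring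
    · rw [blockValue, finFunctionFinEquiv_apply, ← Equiv.sum_comp Fin.revPerm]
      simp only [Fin.revPerm_apply, Function.comp_apply, Fin.rev_rev]
      rw [Finset.sum_range, Finset.mul_sum]
      push_cast
      refine Finset.sum_congr rfl fun i _ => ?_
      have hi : m = Fin.rev i + (i + 1) := by
        have := i.2
        rw [Fin.val_rev]
        omega
      have hp : (b : ℝ) ^ m = b ^ (Fin.rev i : ℕ) * b ^ ((i : ℕ) + 1) := by
        rw [← pow_add, ← hi]
      rw [Real.ofDigitsTerm, hp, add_assoc, pow_add, seqBlock, seqOfReal]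
      field_simp
      ring
  exact_mod_cast h

/-- The value of `u` is that of `v` plus `e - 1`, modulo `b ^ m`. -/
def ShiftedBlock {b m : ℕ} (e : Fin 3) (u v : Fin m → Fin b) : Prop :=
  (blockValue u + 1 : ℤ) ≡ blockValue v + (e : ℕ) [ZMOD (b ^ m : ℕ)]

theorem ShiftedBlock.left_unique {b m : ℕ} {e : Fin 3} {u u' v : Fin m → Fin b}
    (h : ShiftedBlock e u v) (h' : ShiftedBlock e u' v) : u = u' := by
  have h1 : (blockValue u : ℤ) ≡ blockValue u' [ZMOD (b ^ m : ℕ)] :=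
    (h.trans h'.symm).add_right_cancel' 1
  have h2 := Int.natCast_modEq_iff.1 h1
  exact blockValue_injective (h2.eq_of_lt_of_lt (blockValue_lt u) (blockValue_lt u'))

/-- The blocks of close real numbers have close values. -/
theorem exists_shiftedBlock {b : ℕ} [NeZero b] {x y : ℝ} (hx : x ∈ Set.Ico (0 : ℝ) 1)
    (hy : y ∈ Set.Ico (0 : ℝ) 1) {m N j : ℕ} (hxy : |y - x| < ((b : ℝ) ^ (N * m))⁻¹) (hj : j < N) :
    ∃ e, ShiftedBlock e (seqBlock (seqOfReal b x) m j) (seqBlock (seqOfReal b y) m j) := by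
  have hb1 : (1 : ℝ) ≤ b := by exact_mod_cast NeZero.one_le
  have hp : (0 : ℝ) < (b : ℝ) ^ ((j + 1) * m) := by positivity
  have hclose : |(b : ℝ) ^ ((j + 1) * m) * y - (b : ℝ) ^ ((j + 1) * m) * x| < 1 := by
    rw [← mul_sub, abs_mul, abs_of_pos hp]
    calc (b : ℝ) ^ ((j + 1) * m) * |y - x| < b ^ ((j + 1) * m) * ((b : ℝ) ^ (N * m))⁻¹ := by gcongr
      _ ≤ b ^ (N * m) * ((b : ℝ) ^ (N * m))⁻¹ := by gcongr; omega
      _ = 1 := mul_inv_cancel₀ (by positivity)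
  have hfx := floor_mul_add_blockValue (b := b) hx m j
  have hfy := floor_mul_add_blockValue (b := b) hy m j
  have hx0 : 0 ≤ (b : ℝ) ^ ((j + 1) * m) * x := mul_nonneg hp.le hx.1
  have hy0 : 0 ≤ (b : ℝ) ^ ((j + 1) * m) * y := mul_nonneg hp.le hy.1
  have h1 := Nat.floor_le hx0
  have h2 := Nat.floor_le hy0
  have h3 := Nat.lt_floor_add_one ((b : ℝ) ^ ((j + 1) * m) * x)
  have h4 := Nat.lt_floor_add_one ((b : ℝ) ^ ((j + 1) * m) * y)
  rw [abs_lt] at hclose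
  set X := ⌊(b : ℝ) ^ ((j + 1) * m) * x⌋₊
  set Y := ⌊(b : ℝ) ^ ((j + 1) * m) * y⌋₊
  have h5 : (X : ℝ) < Y + 2 := by linarith
  have h6 : (Y : ℝ) < X + 2 := by linarith
  have h5' : X < Y + 2 := by exact_mod_cast h5
  have h6' : Y < X + 2 := by exact_mod_cast h6
  -- Since `Y ≤ X + 1`, the natural subtraction is exact. Modulo `b ^ m` the earlier digits vanish,
  -- so the difference of the block values is `X - Y`.
  refine ⟨⟨X + 1 - Y, by omega⟩, ?_⟩
  rw [ShiftedBlock, Int.modEq_iff_dvd]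
  refine ⟨(⌊(b : ℝ) ^ (j * m) * x⌋₊ : ℤ) - ⌊(b : ℝ) ^ (j * m) * y⌋₊, ?_⟩
  have hfx' : (X : ℤ) = (b ^ m : ℕ) * (⌊(b : ℝ) ^ (j * m) * x⌋₊ : ℤ) +
      blockValue (seqBlock (seqOfReal b x) m j) := by exact_mod_cast hfx
  have hfy' : (Y : ℤ) = (b ^ m : ℕ) * (⌊(b : ℝ) ^ (j * m) * y⌋₊ : ℤ) +
      blockValue (seqBlock (seqOfReal b y) m j) := by exact_mod_cast hfy
  have he : ((X + 1 - Y : ℕ) : ℤ) = X + 1 - Y := by omega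
  simp only [he]
  linear_combination hfx' - hfy'

theorem realOfStr_mem_Ico {b : ℕ} [NeZero b] (hb : 2 ≤ b) (w : List (Fin b)) :
    realOfStr w ∈ Set.Ico (0 : ℝ) 1 := by
  refine ⟨Real.ofDigits_nonneg _, ?_⟩
  rw [realOfStr, ← Real.ofDigits_const_last_eq_one' (b := b) hb]
  refine Summable.tsum_lt_tsum (i := w.length) (fun i => ?_) ?_ Real.summable_ofDigitsTerm
    Real.summable_ofDigitsTerm
  · refine mul_le_mul_of_nonneg_right ?_ (by positivity)
    exact_mod_cast Nat.le_sub_one_of_lt (w.getD i 0).2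
  · refine mul_lt_mul_of_pos_right ?_ (by positivity)
    simp
    omega

/-- Padding with zeros never ends in digits `b - 1`, because `b ≥ 2`; so the padded string is the
canonical expansion. -/
theorem seqOfReal_realOfStr {b : ℕ} [NeZero b] (hb : 2 ≤ b) (w : List (Fin b)) :
    seqOfReal b (realOfStr w) = fun i => w.getD i 0 := by
  refine ((seqOfReal_eq_iff hb (realOfStr_mem_Ico hb w) _).2 ⟨rfl, fun N => ?_⟩).symm
  refine ⟨N + w.length, by omega, ?_⟩
  simp
  omega

/-! ### From a transducer to a gambler, and the reverse inequality of dimensions -/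

/-- A gambler that wins on all real numbers that have short descriptions by a transducer. -/
theorem FST.exists_FSGambler {b : ℕ} [NeZero b] (hb : 2 ≤ b) (T : FST (Fin b)) :
    ∃ c : ℕ, ∀ m t : ℕ, 0 < m → c * (m + 1) ≤ b ^ t → ∃ G : FSGambler (Fin b),
      ∀ x ∈ Set.Ico (0 : ℝ) 1, ∀ (N : ℕ) (p : List (Fin b)),
        |realOfStr (T.eval p) - x| < ((b : ℝ) ^ (N * m))⁻¹ →
        (b : ℚ≥0) ^ (m * N) ≤
          b ^ (t * N + p.length) * G.martingale (seqPrefix (seqOfReal b x) (N * m)) := by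
  classical
  obtain ⟨R, hR⟩ := T.exists_length_out_le
  have hQ := T.finite
  have hV : Finite {v : List (Fin b) // v.length ≤ R} := (List.finite_length_le _ R).to_subtype
  have := Fintype.ofFinite T.Q
  have := Fintype.ofFinite {v : List (Fin b) // v.length ≤ R}
  refine ⟨1 + 3 * Fintype.card (T.Q × {v : List (Fin b) // v.length ≤ R}),
    fun m t hm hct => ?_⟩
  have hb1 : (1 : ℚ≥0) ≤ b := by exact_mod_cast NeZero.one_le
  have hb0 : (0 : ℚ≥0) < b := by positivity
  -- `some` records the shift, the state with its pending output, and the input length. `none`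
  -- stands for uniformly random blocks: it makes every weight positive and covers input pieces
  -- longer than `m`.
  let Θ : Type := Option (Fin 3 × (T.Q × {v : List (Fin b) // v.length ≤ R}) × Fin (m + 1))
  let ℓ : Θ → ℕ := fun θ => θ.elim m fun θ => θ.2.2
  let F : Θ → List (Fin b) → Fin m → Fin b := fun θ w => θ.elim (fun i => w.getD i 0) fun θ =>
    if h : ∃ u, ShiftedBlock θ.1 u
      (fun i : Fin m => (θ.2.1.2.1 ++ T.outFrom θ.2.1.1 w).getD i 0) then h.choose else 0
  obtain ⟨ω, hsum, hω⟩ := exists_mixture (NeZero.pos b) ℓ F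
  have hΘ : (Fintype.card Θ : ℚ≥0) ≤ b ^ t := by
    have h1 : Fintype.card Θ =
        3 * (Fintype.card (T.Q × {v : List (Fin b) // v.length ≤ R}) * (m + 1)) + 1 := by
      rw [Fintype.card_option, Fintype.card_prod, Fintype.card_prod (T.Q × _), Fintype.card_fin,
        Fintype.card_fin]
    have h2 : Fintype.card Θ ≤ b ^ t := by
      rw [h1]
      linarith
    exact_mod_cast h2
  have hraw : ∀ u, 1 ≤ (b : ℚ≥0) ^ t * b ^ m * ω u := by
    intro u
    have h1 := hω none (List.ofFn u) (by simp [ℓ])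
    have h2 : F none (List.ofFn u) = u := by
      funext i
      simp [F]
    rw [h2, List.length_ofFn] at h1
    exact h1.trans (by gcongr)
  have hpos : ∀ u, 0 < ω u := by
    intro u
    refine pos_of_ne_zero fun h => ?_
    have := hraw u
    rw [h, mul_zero] at this
    exact absurd this (by norm_num)
  obtain ⟨G, hG⟩ := exists_FSGambler_of_blockMeasure hm ω hpos hsum
  refine ⟨G, fun x hx N p hp => ?_⟩
  have hprod := T.one_le_prod_of_near hR ω ((b : ℚ≥0) ^ t)
    (fun u u' => ∃ e, ShiftedBlock e u u') (fun q v w u hv ⟨e, he⟩ => by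
      by_cases hw : w.length ≤ m
      · let θ : Θ := some (e, (q, ⟨v, hv⟩), ⟨w.length, Nat.lt_succ_of_le hw⟩)
        have h1 := hω θ w rfl
        have h2 : F θ w = u := by
          have hex : ∃ u, ShiftedBlock e u (fun i : Fin m => (v ++ T.outFrom q w).getD i 0) :=
            ⟨u, he⟩
          -- The shift and the output block determine `u`, so the choice in `F` is forced.
          exact (dif_pos hex).trans (hex.choose_spec.left_unique he)
        rw [h2] at h1
        exact h1.trans (by gcongr)
      · refine (hraw u).trans ?_
        have := pow_le_pow_right₀ hb1 (not_le.1 hw).le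
        gcongr)
    N T.start [] p (seqOfReal b x) (Nat.zero_le _) (fun j hj => by
      have h := exists_shiftedBlock hx (realOfStr_mem_Ico hb _) hp hj
      rw [seqOfReal_realOfStr hb] at h
      exact h)
  rw [hG, Finset.prod_mul_distrib, Finset.prod_const, Finset.card_range, Fintype.card_fin]
  calc (b : ℚ≥0) ^ (m * N) = b ^ (m * N) * 1 := (mul_one _).symm
    _ ≤ b ^ (m * N) * (((b : ℚ≥0) ^ t) ^ N * b ^ p.length *
        ∏ j ∈ Finset.range N, ω (seqBlock (seqOfReal b x) m j)) := by gcongr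
    _ = _ := by ring

theorem FST.exists_length_le_of_KReal_le {b : ℕ} [NeZero b] {T : FST (Fin b)} {δ x : ℝ} {k : ℕ}
    (h : T.KReal δ x ≤ k) : ∃ p : List (Fin b), p.length ≤ k ∧ |realOfStr (T.eval p) - x| < δ := by
  have h1 : T.KReal δ x < (k + 1 : ℕ) := h.trans_lt (by exact_mod_cast Nat.lt_succ_self k)
  simp only [FST.KReal, FST.K, iInf_lt_iff] at h1
  obtain ⟨w, hw, p, rfl, hp⟩ := h1
  exact ⟨p, Nat.le_of_lt_succ (by exact_mod_cast hp), hw⟩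

theorem FST.exists_length_lt {b : ℕ} [NeZero b] {T : FST (Fin b)} {δ x a : ℝ} {r : ℝ≥0}
    (ha : 0 < a) (h : (T.KReal δ x : ℝ≥0∞) / ENNReal.ofReal a < r) :
    ∃ p : List (Fin b), (p.length : ℝ) < r * a ∧ |realOfStr (T.eval p) - x| < δ := by
  rw [ENNReal.div_lt_iff (Or.inl (ENNReal.ofReal_pos.2 ha).ne') (Or.inl ENNReal.ofReal_ne_top),
    ← ENNReal.ofReal_coe_nnreal, ← ENNReal.ofReal_mul (NNReal.coe_nonneg r)] at h
  have htop : T.KReal δ x ≠ ⊤ := fun h1 => by simp [h1] at h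
  obtain ⟨k, hk⟩ := ENat.ne_top_iff_exists.1 htop
  obtain ⟨p, hp, hpx⟩ := FST.exists_length_le_of_KReal_le hk.ge
  refine ⟨p, ?_, hpx⟩
  rw [← hk, ENat.toENNReal_coe, ← ENNReal.ofReal_natCast,
    ENNReal.ofReal_lt_ofReal_iff_of_nonneg (Nat.cast_nonneg k)] at h
  exact lt_of_le_of_lt (by exact_mod_cast hp) h

theorem exists_FSGambler_succeeds {b : ℕ} [NeZero b] (hb : 2 ≤ b) (T : FST (Fin b)) (r : ℝ≥0)
    {ε : ℝ≥0} (hε : 0 < ε) :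
    ∃ G : FSGambler (Fin b), ∀ x ∈ Set.Ico (0 : ℝ) 1, T.lowerRate x ≤ r →
      G.Succeeds (r + ε) (seqOfReal b x) := by
  obtain ⟨c, hc⟩ := T.exists_FSGambler hb
  have hε4 : (0 : ℝ) < ε / 4 := by positivity
  obtain ⟨m, t, hm, -, hct, hmt⟩ := exists_block_params hb c hε4
  obtain ⟨G, hG⟩ := hc m t hm hct
  refine ⟨G, fun x hx hr => ?_⟩
  have hb0 : (0 : ℝ) < b := by positivity
  have hb1 : (1 : ℝ) < b := by exact_mod_cast hb
  have hm0 : (0 : ℝ) < m := by exact_mod_cast hm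
  have hlog : Tendsto (fun δ : ℝ => Real.logb b (1 / δ)) (𝓝[>] 0) atTop := by
    simp only [one_div]
    exact (Real.tendsto_logb_atTop hb1).comp tendsto_inv_nhdsGT_zero
  have hN : Tendsto (fun δ : ℝ => ⌊Real.logb b (1 / δ) / m⌋₊) (𝓝[>] 0) atTop :=
    tendsto_nat_floor_atTop.comp (hlog.atTop_div_const hm0)
  have hNm : Tendsto (fun δ : ℝ => ⌊Real.logb b (1 / δ) / m⌋₊ * m) (𝓝[>] 0) atTop :=
    tendsto_atTop_mono (fun δ => Nat.le_mul_of_pos_right _ hm) hN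
  have hfreq : ∃ᶠ δ in 𝓝[>] (0 : ℝ),
      (T.KReal δ x : ℝ≥0∞) / ENNReal.ofReal (Real.logb b (1 / δ)) < (r + ε / 4 : ℝ≥0) := by
    refine frequently_lt_of_liminf_lt (by isBoundedDefault) (lt_of_le_of_lt hr ?_)
    exact_mod_cast lt_add_of_pos_right r (by positivity)
  rw [FSGambler.Succeeds]
  refine ENNReal.eq_top_of_forall_nnreal_le fun M => ?_
  refine le_limsup_of_frequently_le' (hNm.frequently ?_)
  have hlarge : ∀ᶠ δ in 𝓝[>] (0 : ℝ), Real.logb b (M + 1) + (r + ε / 4) * m ≤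
      ε / 4 * m * (⌊Real.logb b (1 / δ) / m⌋₊ : ℝ) :=
    ((tendsto_natCast_atTop_atTop.comp hN).const_mul_atTop (by positivity)).eventually_ge_atTop _
  refine (hfreq.and_eventually (hlarge.and ((hlog.eventually_gt_atTop 0).and
    self_mem_nhdsWithin))).mono ?_
  rintro δ ⟨hK, hδ, hpos, hδ0⟩
  have hδ0 : 0 < δ := hδ0
  obtain ⟨p, hplen, hpx⟩ := FST.exists_length_lt hpos hK
  set L := Real.logb b (1 / δ) with hL
  set N := ⌊L / m⌋₊
  have hN1 : (N : ℝ) * m ≤ L := by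
    have := Nat.floor_le (div_nonneg hpos.le hm0.le)
    rwa [le_div_iff₀ hm0] at this
  have hN2 : L < (N + 1) * m := by
    have := Nat.lt_floor_add_one (L / m)
    rwa [div_lt_iff₀ hm0] at this
  have hδN : δ ≤ ((b : ℝ) ^ (N * m))⁻¹ := by
    have h1 : (b : ℝ) ^ (((N * m : ℕ) : ℝ)) ≤ (b : ℝ) ^ L :=
      Real.rpow_le_rpow_of_exponent_le hb1.le (by push_cast; exact hN1)
    rw [hL, Real.rpow_logb hb0 hb1.ne' (by positivity), Real.rpow_natCast, one_div] at h1
    exact (le_inv_comm₀ (by positivity) hδ0).1 h1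
  have hmart := hG x hx N p (hpx.trans_le hδN)
  have hmart' : (b : ℝ) ^ (m * N) ≤ b ^ (t * N + p.length) *
      ((G.martingale (seqPrefix (seqOfReal b x) (N * m)) : ℚ≥0) : ℝ) := by exact_mod_cast hmart
  rw [← ENNReal.ofReal_coe_nnreal]
  refine ENNReal.ofReal_le_ofReal ?_
  -- Of the gain `ε * N * m`, a quarter pays the headers, a quarter the excess of the description
  -- rate over `r`, and a quarter the constants and `M`.
  have hexp : Real.logb b (M + 1) ≤ (((r + ε : ℝ≥0) : ℝ) - 1) * (N * m : ℕ) + (m * N : ℕ) -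
      (t * N + p.length : ℕ) := by
    have h1 : (t : ℝ) * N ≤ ε / 4 * m * N := by
      have : (t : ℝ) ≤ ε / 4 * m := by linarith
      gcongr
    have h2 : (p.length : ℝ) ≤ (r + ε / 4) * ((N + 1) * m) := by
      refine hplen.le.trans ?_
      push_cast
      gcongr
    have h3 : (0 : ℝ) ≤ ε / 4 * m * N := by positivity
    push_cast
    nlinarith
  calc (M : ℝ) ≤ M + 1 := by linarith
    _ = (b : ℝ) ^ Real.logb b (M + 1) := (Real.rpow_logb hb0 hb1.ne' (by positivity)).symm
    _ ≤ (b : ℝ) ^ ((((r + ε : ℝ≥0) : ℝ) - 1) * (N * m : ℕ) + (m * N : ℕ) -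
      (t * N + p.length : ℕ)) := Real.rpow_le_rpow_of_exponent_le hb1.le hexp
    _ = (b : ℝ) ^ ((((r + ε : ℝ≥0) : ℝ) - 1) * (N * m : ℕ)) *
        ((b : ℝ) ^ (m * N) / (b : ℝ) ^ (t * N + p.length)) := by
      rw [Real.rpow_sub hb0, Real.rpow_add hb0, Real.rpow_natCast, Real.rpow_natCast, mul_div_assoc]
    _ ≤ G.gale (r + ε) (seqPrefix (seqOfReal b x) (N * m)) := by
      rw [FSGambler.gale, Fintype.card_fin, length_seqPrefix]
      refine mul_le_mul_of_nonneg_left ?_ (by positivity)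
      rwa [div_le_iff₀' (by positivity)]

/-- The supremum of the rates over `A` serves as one exponent `r` for all points, so a single
gambler succeeds on the whole image; an infinite supremum is trivial. -/
theorem dimFSSeqSet_le_dimFSRealSet {b : ℕ} [NeZero b] (hb : 2 ≤ b) {A : Set ℝ}
    (hA : A ⊆ Set.Ico (0 : ℝ) 1) : dimFSSeqSet (seqOfReal b '' A) ≤ dimFSRealSet b A := by
  refine le_iInf fun T => ?_
  refine ENNReal.le_of_forall_pos_le_add fun ε hε htop => ?_
  obtain ⟨r, hr⟩ : ∃ r : ℝ≥0, (r : ℝ≥0∞) = ⨆ x ∈ A, T.lowerRate x :=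
    ⟨_, ENNReal.coe_toNNReal htop.ne⟩
  obtain ⟨G, hG⟩ := exists_FSGambler_succeeds hb T r hε
  rw [← hr, ← ENNReal.coe_add]
  refine iInf₂_le (r + ε) ⟨G, ?_⟩
  rintro _ ⟨x, hx, rfl⟩
  exact hG x (hA hx) (hr ▸ le_iSup₂ (f := fun x (_ : x ∈ A) => T.lowerRate x) x hx)

theorem mainTheorem1 (b : ℕ) [NeZero b] (hb : 2 ≤ b) (x : ℝ) (hx : x ∈ Set.Ico (0 : ℝ) 1)
    (A : Set ℝ) (hA : A ⊆ Set.Ico (0 : ℝ) 1) :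
    dimFSReal b x = dimFSSeq (seqOfReal b x) ∧
      dimFSRealSet b A = dimFSSeqSet (seqOfReal b '' A) := by
  have h : ∀ A : Set ℝ, A ⊆ Set.Ico (0 : ℝ) 1 →
      dimFSRealSet b A = dimFSSeqSet (seqOfReal b '' A) := fun A hA =>
    le_antisymm (dimFSRealSet_le_dimFSSeqSet hb hA) (dimFSSeqSet_le_dimFSRealSet hb hA)
  refine ⟨?_, h A hA⟩
  have h1 := h {x} (Set.singleton_subset_iff.2 hx)
  rw [Set.image_singleton] at h1
  rw [dimFSSeq, ← h1]
  simp [dimFSReal, dimFSRealSet]
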